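/- Let $\mathcal P$ be the set of Borel probability measures supported on $\mathbb R_+=[0,\infty)$. For $F,G\in\mathcal P$ let $d_{\rm OT}(F,G)=\inf_{\Gamma}\int |u-v|^2\,{\rm d}\Gamma(u,v)$, where $\Gamma$ ranges over all joint distributions on $\mathbb R_+\times\mathbb R_+$ with marginals $F$ and $G$, and for $\mathcal A\subseteq\mathcal P$ let $d(F,\mathcal A)=\inf_{G\in\mathcal A}d_{\rm OT}(F,G)$ (with $\inf\emptyset=\infty$). Let $\mu\in\mathbb R$, $\sigma\ge 0$ and $\nu\ge 0$. Then there are constants $c_1,c_2>0$, depending only on $\mu$, $\sigma$ and $\nu$, such that the following holds. Let $D\in\mathcal P$ have mean $\mu$ and standard deviation $\sigma$ and be sub-Gaussian with variance proxy $\nu^2$, that is, $\mathbb E_D[\exp(x(\tilde v-\mu))]\le\exp(x^2\nu^2/2)$ for all $x\in\mathbb R$. For independent samples $\hat v_1,\dots,\hat v_N$ from $D$ put $\hat\mu=\frac1N\sum_{i=1}^N\hat v_i$ and $\hat\sigma^2=\frac1N\sum_{i=1}^N\hat v_i^2-\hat\mu^2$, and let $$\mathcal A_N=\{G\in\mathcal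 P \mid \mathbb E_G[\tilde v]=\hat\mu,\ \mathbb E_G[\tilde v^2]=\hat\mu^2+\hat\sigma^2\}.$$ Then for every $\eta\in(0,1]$ and all sufficiently large $N$ (how large may depend on $D$ and $\eta$), $$\mathbb P_{D^N}\Big[d(D,\mathcal A_N)\le\frac{(c_1+c_2\log(1/\eta))^2}{\sqrt N}\Big]\ge 1-\eta,$$ where $D^N$ is the $N$-fold product of $D$. -/

import Mathlib

open MeasureTheory ProbabilityTheory Filter
open scoped NNReal ENNReal

noncomputable section

/-- The Borel probability measures on `ℝ` that are supported on `ℝ₊ = [0, ∞)`. -/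
def demandDistributions : Set (Measure ℝ) :=
  {G | IsProbabilityMeasure G ∧ G (Set.Iio 0) = 0}

/-- The set of couplings of `F` and `G`: joint laws with marginals `F` and `G`. When `F` and `G`
are supported on `ℝ₊`, every such coupling is supported on `ℝ₊ × ℝ₊`. -/
def couplings (F G : Measure ℝ) : Set (Measure (ℝ × ℝ)) :=
  {Γ | IsProbabilityMeasure Γ ∧ Γ.map Prod.fst = F ∧ Γ.map Prod.snd = G}

/-- The optimal-transport cost between `F` and `G` for the quadratic cost `|u - v|²`. -/
def otCost (F G : Measure ℝ) : ℝ≥0∞ :=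
  ⨅ Γ ∈ couplings F G, ∫⁻ p : ℝ × ℝ, ENNReal.ofReal (|p.1 - p.2| ^ 2) ∂Γ

/-- The optimal-transport cost `d(F, 𝒜)` from `F` to a set `𝒜` of distributions
(`∞` if `𝒜` is empty). -/
def otCostToSet (F : Measure ℝ) (𝒜 : Set (Measure ℝ)) : ℝ≥0∞ :=
  ⨅ G ∈ 𝒜, otCost F G

/-- The mean-variance ambiguity set with mean `m` and variance `s2`: all distributions on `ℝ₊`
with finite second moment, mean `m` and second moment `m² + s2`. -/
def meanVarianceSet (m s2 : ℝ) : Set (Measure ℝ) :=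
  {G | G ∈ demandDistributions ∧ MemLp id 2 G ∧ ∫ x, x ∂G = m ∧ ∫ x, x ^ 2 ∂G = m ^ 2 + s2}

/-- The sample mean `(1/N) ∑ vᵢ`. -/
def sampleMean {N : ℕ} (v : Fin N → ℝ) : ℝ :=
  1 / (N : ℝ) * ∑ i, v i

/-- The sample variance `(1/N) ∑ vᵢ² - ((1/N) ∑ vᵢ)²`. -/
def sampleVariance {N : ℕ} (v : Fin N → ℝ) : ℝ :=
  1 / (N : ℝ) * ∑ i, v i ^ 2 - (1 / (N : ℝ) * ∑ i, v i) ^ 2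

/-- The ambiguity set estimated from the sample `v`. -/
def estimatedSet {N : ℕ} (v : Fin N → ℝ) : Set (Measure ℝ) :=
  meanVarianceSet (sampleMean v) (sampleVariance v)

end

/-! The proof splits on whether `D` charges at least two positive regions or is carried by `{0, c}`.
In the first case some `[ε, ∞)` carries a nondegenerate part of `D`. An affine map acting there
alone can correct both moments, so moment errors of size `t` cost only `O(t²)`
(`exists_otCostToSet_le_sq`). Taking `t` of order `N^(-1/4)`, far above the sampling error,
Chebyshev makes the failure probability vanish: any constant over `√N` works for large `N`, and
fourth moments suffice. In the second case that correction may be impossible, but the sample also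
lies in `{0, c}`, so the two-point law with the sample mean has exactly the estimated moments. Its
cost is linear in the error of the mean (`otCost_twoPointLaw_le`), and Hoeffding gives order
`√(log(1/η)/N)`. Since `c` is a function of `μ` and `σ`, so are the constants. -/

/-! ### Transport maps and perturbation of two moments. -/

/-- The transport cost from a law to its push-forward under `T` is at most that of the map `T`. -/
theorem otCost_map_le (D : Measure ℝ) [IsProbabilityMeasure D] {T : ℝ → ℝ} (hT : Measurable T) :
    otCost D (D.map T) ≤ ∫⁻ x, ENNReal.ofReal (|x - T x| ^ 2) ∂D := by
  have hm : Measurable fun x : ℝ => (x, T x) := measurable_id.prodMk hT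
  refine (iInf₂_le (D.map fun x => (x, T x)) ⟨Measure.isProbabilityMeasure_map hm.aemeasurable,
    ?_, ?_⟩).trans (le_of_eq ?_)
  · exact lintegral_map (f := fun p : ℝ × ℝ => ENNReal.ofReal (|p.1 - p.2| ^ 2))
      (by fun_prop) hm
  · rw [Measure.map_map measurable_fst hm]
    exact Measure.map_id
  · rw [Measure.map_map measurable_snd hm]
    rfl

theorem otCostToSet_le_of_mem {D G : Measure ℝ} {𝒜 : Set (Measure ℝ)} (hG : G ∈ 𝒜) :
    otCostToSet D 𝒜 ≤ otCost D G :=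
  iInf₂_le G hG

theorem setIntegral_quadratic {D : Measure ℝ} [IsProbabilityMeasure D] (h2 : MemLp id 2 D)
    (B : Set ℝ) (α β γ : ℝ) :
    ∫ x in B, (α + β * x + γ * x ^ 2) ∂D =
      α * D.real B + β * ∫ x in B, x ∂D + γ * ∫ x in B, x ^ 2 ∂D := by
  have i1 : Integrable (fun x : ℝ => x) (D.restrict B) :=
    (h2.integrable (by norm_num)).restrict
  have i2 : Integrable (fun x : ℝ => x ^ 2) (D.restrict B) := h2.integrable_sq.restrict
  have i3 : Integrable (fun x : ℝ => α + β * x) (D.restrict B) :=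
    (integrable_const α).add (i1.const_mul β)
  rw [integral_add i3 (i2.const_mul γ), integral_add (integrable_const α) (i1.const_mul β),
    integral_const_mul, integral_const_mul]
  simp [mul_comm]

set_option maxHeartbeats 1000000 in
/-- If `D` is not concentrated on one point within `[ε, ∞)`, then every small perturbation of its
first two moments is realised at a transport cost quadratic in the size of the perturbation. -/
theorem exists_otCostToSet_le_sq {D : Measure ℝ} (hD : D ∈ demandDistributions)
    (h2 : MemLp id 2 D) {ε : ℝ} (hε : 0 < ε) (hne : ¬ ∃ c, ∀ᵐ x ∂D, ε ≤ x → x = c) :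
    ∃ C r : ℝ, 0 < C ∧ 0 < r ∧ ∀ t m q : ℝ, t ≤ r → |m - ∫ x, x ∂D| ≤ t →
      |q - ∫ x, x ^ 2 ∂D| ≤ t →
      otCostToSet D (meanVarianceSet m (q - m ^ 2)) ≤ ENNReal.ofReal (C * t ^ 2) := by
  obtain ⟨hDp, hD0⟩ := hD
  have i1 : Integrable (fun x : ℝ => x) D := h2.integrable (by norm_num)
  have i2 : Integrable (fun x : ℝ => x ^ 2) D := h2.integrable_sq
  have hB : MeasurableSet (Set.Ici ε) := measurableSet_Ici
  set B := Set.Ici ε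
  set p := D.real B with hp
  set A := ∫ x in B, x ∂D with hA
  set Q := ∫ x in B, x ^ 2 ∂D with hQ
  have hp0 : 0 < p := by
    rcases measureReal_nonneg.lt_or_eq with h | h
    · exact h
    refine absurd ⟨0, ?_⟩ hne
    have : D B = 0 := (measureReal_eq_zero_iff (measure_ne_top D B)).1 h.symm
    filter_upwards [measure_eq_zero_iff_ae_notMem.1 this] with x hx hx'
    exact absurd hx' hx
  -- `a` is the mean of `D` conditioned on `B`, and `V` is `p` times the conditional variance.
  set a := A / p with ha
  have hAa : A = a * p := by rw [ha]; field_simp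
  set V := Q - a ^ 2 * p with hV
  have hVint : ∫ x in B, (x - a) ^ 2 ∂D = V := by
    have := setIntegral_quadratic h2 B (a ^ 2) (-2 * a) 1
    rw [← hp, ← hA, ← hQ, hAa] at this
    rw [hV, show Q - a ^ 2 * p = a ^ 2 * p + -2 * a * (a * p) + 1 * Q by ring, ← this]
    congr with x; ring
  have hV0 : 0 < V := by
    rcases (hVint ▸ integral_nonneg fun x => sq_nonneg (x - a) : 0 ≤ V).lt_or_eq with h | h
    · exact h
    refine absurd ⟨a, ?_⟩ hne
    have hi : Integrable (fun x : ℝ => (x - a) ^ 2) (D.restrict B) :=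
      ((h2.sub (memLp_const a)).integrable_sq).restrict
    have := (integral_eq_zero_iff_of_nonneg (fun x => sq_nonneg (x - a)) hi).1
      (hVint.trans h.symm)
    filter_upwards [(ae_restrict_iff' hB).1 this] with x hx hxB
    have h0 : (x - a) ^ 2 = 0 := hx hxB
    nlinarith [pow_eq_zero_iff (two_ne_zero) |>.1 h0]
  set K := 1 + 2 * |a| + 1 / p with hK
  have hK0 : 0 < K := by positivity
  have hL0 : 0 < 1 / p + K * |a| / V := by positivity
  -- The three bounds on `t` make the quadratic term `d * δ₁` linear in `t`, keep `|h / V| ≤ 1 / 2`,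
  -- and keep the displaced mass nonnegative.
  refine ⟨1 / p + K ^ 2 / V, min 1 (min (V / (2 * K)) (ε / 2 / (1 / p + K * |a| / V))),
    by positivity, by positivity, fun t m q htr hm hq => ?_⟩
  obtain ⟨ht1, htr⟩ := le_min_iff.1 htr
  obtain ⟨ht2, ht3⟩ := le_min_iff.1 htr
  rw [le_div_iff₀ (by positivity)] at ht2 ht3
  have ht0 : 0 ≤ t := (abs_nonneg _).trans hm
  set δ₁ := m - ∫ x, x ∂D with hδ₁
  set δ₂ := q - ∫ x, x ^ 2 ∂D with hδ₂
  set d := δ₁ / p with hd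
  have hdp : d * p = δ₁ := by rw [hd]; field_simp
  have hdt : |d| ≤ t / p := by
    rw [hd, abs_div, abs_of_pos hp0]; gcongr
  -- Moving `x ∈ B` by `d + e * (x - a)` changes the mean by `d * p` and the second moment by `2 * a
  -- * δ₁ + d * δ₁ + V * (e ^ 2 + 2 * e)`; hence `d`, and `h` as the target for the last term.
  set h := δ₂ - 2 * a * δ₁ - d * δ₁ with hh
  have hht : |h| ≤ K * t := by
    have e1 : |2 * a * δ₁| ≤ 2 * |a| * t := by
      rw [abs_mul, abs_mul, abs_two]; gcongr
    have e2 : |d * δ₁| ≤ t / p * 1 := by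
      rw [abs_mul]; gcongr; exact hm.trans ht1
    calc |h| ≤ |δ₂| + |2 * a * δ₁| + |d * δ₁| := (abs_sub _ _).trans (by gcongr; exact abs_sub _ _)
      _ ≤ t + 2 * |a| * t + t / p * 1 := by gcongr
      _ = K * t := by rw [hK]; ring
  have hhV : |h / V| ≤ K * t / V := by
    rw [abs_div, abs_of_pos hV0]; gcongr
  have hhV2 : |h / V| ≤ 1 / 2 := hhV.trans (by rw [div_le_iff₀ hV0]; linarith)
  have hpos : 0 ≤ 1 + h / V := by linarith [(abs_le.1 hhV2).1]
  -- The root near `0`, which is at most linear in `h`.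
  set e := Real.sqrt (1 + h / V) - 1 with he
  have hesq : V * (e ^ 2 + 2 * e) = h := by
    have : (e + 1) ^ 2 = 1 + h / V := by rw [he, sub_add_cancel, Real.sq_sqrt hpos]
    have h3 : e ^ 2 + 2 * e = h / V := by linarith
    rw [h3]; field_simp
  have heV : |e| ≤ |h / V| := by
    have h3 : e * (Real.sqrt (1 + h / V) + 1) = h / V := by
      rw [he]; linarith [Real.mul_self_sqrt hpos]
    rw [← h3, abs_mul]
    exact le_mul_of_one_le_right (abs_nonneg _)
      (by rw [abs_of_nonneg (by positivity)]; linarith [Real.sqrt_nonneg (1 + h / V)])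
  set g : ℝ → ℝ := B.indicator fun x => d + e * (x - a) with hg
  have hgm : Measurable g := Measurable.indicator (by fun_prop) hB
  have hTm : Measurable fun x => x + g x := by fun_prop
  have hgL : MemLp g 2 D := by
    refine MemLp.indicator hB ?_
    exact (memLp_const d).add ((h2.sub (memLp_const a)).const_mul e)
  have hTL : MemLp (fun x => x + g x) 2 D := h2.add hgL
  have hgI : ∫ x, g x ∂D = δ₁ := by
    rw [hg, integral_indicator hB]
    have := setIntegral_quadratic h2 B (d - e * a) e 0
    rw [← hp, ← hA, hAa] at this
    rw [← hdp, show d * p = (d - e * a) * p + e * (a * p) + 0 * ∫ x in B, x ^ 2 ∂D by ring, ← this]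
    congr with x; ring
  have hg2 : ∫ x, g x ^ 2 ∂D = d ^ 2 * p + e ^ 2 * V := by
    have e0 : (fun x => g x ^ 2) = B.indicator fun x => (d + e * (x - a)) ^ 2 := by
      ext x; by_cases hx : x ∈ B <;> simp [hg, hx]
    rw [e0, integral_indicator hB]
    have := setIntegral_quadratic h2 B ((d - e * a) ^ 2) (2 * e * (d - e * a)) (e ^ 2)
    rw [← hp, ← hA, ← hQ, hAa] at this
    rw [hV, show d ^ 2 * p + e ^ 2 * (Q - a ^ 2 * p) = (d - e * a) ^ 2 * p
      + 2 * e * (d - e * a) * (a * p) + e ^ 2 * Q by ring, ← this]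
    congr with x; ring
  have hxg : ∫ x, x * g x ∂D = a * δ₁ + e * V := by
    have e0 : (fun x => x * g x) = B.indicator fun x => x * (d + e * (x - a)) := by
      ext x; by_cases hx : x ∈ B <;> simp [hg, hx]
    rw [e0, integral_indicator hB]
    have := setIntegral_quadratic h2 B 0 (d - e * a) e
    rw [← hp, ← hA, ← hQ, hAa] at this
    rw [hV, ← hdp, show a * (d * p) + e * (Q - a ^ 2 * p) = 0 * p
      + (d - e * a) * (a * p) + e * Q by ring, ← this]
    congr with x; ring
  have hxgi : Integrable (fun x => x * g x) D := h2.integrable_mul hgL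
  have hcost : d ^ 2 * p + e ^ 2 * V ≤ (1 / p + K ^ 2 / V) * t ^ 2 := by
    have e1 : d ^ 2 ≤ (t / p) ^ 2 := sq_le_sq.2 (by rwa [abs_of_nonneg (by positivity : 0 ≤ t / p)])
    have e2 : e ^ 2 ≤ (K * t / V) ^ 2 :=
      sq_le_sq.2 ((heV.trans hhV).trans (le_abs_self _))
    calc d ^ 2 * p + e ^ 2 * V ≤ (t / p) ^ 2 * p + (K * t / V) ^ 2 * V := by gcongr
      _ = _ := by field_simp
  have hG : D.map (fun x => x + g x) ∈ meanVarianceSet m (q - m ^ 2) := by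
    refine ⟨⟨Measure.isProbabilityMeasure_map hTm.aemeasurable, ?_⟩, ?_, ?_, ?_⟩
    · rw [Measure.map_apply hTm measurableSet_Iio]
      refine measure_mono_null (fun x hx => ?_) hD0
      simp only [Set.mem_preimage, Set.mem_Iio] at hx ⊢
      by_contra hx0
      by_cases hxB : x ∈ B
      · have hgx : g x = d + e * (x - a) := by simp [hg, hxB]
        rw [hgx] at hx
        have hxε : ε ≤ x := hxB
        have he2 : -(1 / 2) ≤ e := (abs_le.1 (heV.trans hhV2)).1
        have hea : e * a ≤ K * t / V * |a| :=
          (le_abs_self _).trans (by rw [abs_mul]; gcongr; exact heV.trans hhV)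
        have hd2 : -(t / p) ≤ d := (abs_le.1 hdt).1
        have h4 : t / p + K * t / V * |a| ≤ ε / 2 := by
          refine le_trans (le_of_eq ?_) ht3
          ring
        -- On `B`, `x + e * x ≥ ε / 2` absorbs the remaining shift `d - e * a`.
        have h5 : -(1 / 2) * x ≤ e * x := mul_le_mul_of_nonneg_right he2 (hε.le.trans hxε)
        linarith
      · simp [hg, hxB] at hx; exact hx0 hx
    · rw [memLp_map_measure_iff aestronglyMeasurable_id hTm.aemeasurable]
      exact hTL
    · rw [integral_map hTm.aemeasurable (f := fun y : ℝ => y) aestronglyMeasurable_id]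
      rw [integral_add i1 (hgL.integrable (by norm_num)), hgI, hδ₁]
      ring
    · rw [integral_map hTm.aemeasurable (by fun_prop)]
      have e0 : ∀ x, (x + g x) ^ 2 = x ^ 2 + 2 * (x * g x) + g x ^ 2 := fun x => by ring
      simp_rw [e0]
      have i3 : Integrable (fun x => x ^ 2 + 2 * (x * g x)) D := i2.add (hxgi.const_mul 2)
      rw [integral_add i3 hgL.integrable_sq,
        integral_add i2 (hxgi.const_mul 2), integral_const_mul, hxg, hg2]
      have : d ^ 2 * p = d * δ₁ := by rw [← hdp]; ring
      rw [this]
      linarith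
  refine (otCostToSet_le_of_mem hG).trans ((otCost_map_le D hTm).trans ?_)
  have e0 : ∀ x, |x - (x + g x)| ^ 2 = g x ^ 2 := fun x => by rw [sq_abs]; ring
  simp_rw [e0]
  rw [← ofReal_integral_eq_lintegral_ofReal hgL.integrable_sq (ae_of_all _ fun x => sq_nonneg _),
    hg2]
  exact ENNReal.ofReal_le_ofReal hcost

/-! ### Laws on two points. -/

/-- The law on `{0, c}` with mean `m`, when `0 ≤ m ≤ c` and `0 < c`. -/
noncomputable def twoPointLaw (c m : ℝ) : Measure ℝ :=
  ENNReal.ofReal (1 - m / c) • Measure.dirac 0 + ENNReal.ofReal (m / c) • Measure.dirac c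

theorem integral_twoPointLaw {c m : ℝ} (hc : 0 < c) (h0 : 0 ≤ m) (hm : m ≤ c) (f : ℝ → ℝ) :
    ∫ x, f x ∂twoPointLaw c m = (1 - m / c) * f 0 + m / c * f c := by
  have h1 : m / c ≤ 1 := (div_le_one hc).2 hm
  have hi : ∀ (r a : ℝ), Integrable f (ENNReal.ofReal r • Measure.dirac a) := fun r a =>
    (integrable_dirac (by simp)).smul_measure ENNReal.ofReal_ne_top
  rw [twoPointLaw, integral_add_measure (hi _ _) (hi _ _), integral_smul_measure,
    integral_smul_measure, integral_dirac, integral_dirac,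
    ENNReal.toReal_ofReal (by linarith), ENNReal.toReal_ofReal (by positivity)]
  rfl

theorem isProbabilityMeasure_twoPointLaw {c m : ℝ} (hc : 0 < c) (h0 : 0 ≤ m) (hm : m ≤ c) :
    IsProbabilityMeasure (twoPointLaw c m) := by
  have h1 : m / c ≤ 1 := (div_le_one hc).2 hm
  constructor
  simp only [twoPointLaw, Measure.coe_add, Measure.coe_smul, Pi.add_apply, Pi.smul_apply,
    measure_univ, smul_eq_mul, mul_one]
  rw [← ENNReal.ofReal_add (by linarith) (by positivity)]
  simp

theorem twoPointLaw_mem_meanVarianceSet {c m : ℝ} (hc : 0 < c) (h0 : 0 ≤ m) (hm : m ≤ c) :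
    twoPointLaw c m ∈ meanVarianceSet m (c * m - m ^ 2) := by
  refine ⟨⟨isProbabilityMeasure_twoPointLaw hc h0 hm, ?_⟩, ?_, ?_, ?_⟩
  · simp [twoPointLaw, hc.le]
  · rw [memLp_two_iff_integrable_sq aestronglyMeasurable_id, twoPointLaw]
    exact ((integrable_dirac (by simp)).smul_measure ENNReal.ofReal_ne_top).add_measure
      ((integrable_dirac (by simp)).smul_measure ENNReal.ofReal_ne_top)
  · rw [integral_twoPointLaw hc h0 hm]
    field_simp
    ring
  · rw [integral_twoPointLaw hc h0 hm]
    field_simp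
    ring

theorem eq_twoPointLaw {D : Measure ℝ} [IsProbabilityMeasure D] {c : ℝ} (hc : 0 < c)
    (hD : ∀ᵐ x ∂D, x = 0 ∨ x = c) :
    D = twoPointLaw c (∫ x, x ∂D) ∧ 0 ≤ ∫ x, x ∂D ∧ ∫ x, x ∂D ≤ c := by
  have hdis : Disjoint ({0} : Set ℝ) {c} := by simpa using hc.ne
  have e : D = D {0} • Measure.dirac 0 + D {c} • Measure.dirac c := by
    rw [← Measure.restrict_singleton, ← Measure.restrict_singleton,
      ← Measure.restrict_union hdis (measurableSet_singleton c)]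
    exact (Measure.restrict_eq_self_of_ae_mem hD).symm
  have hi : ∀ a : ℝ, Integrable (fun x : ℝ => x) (D {a} • Measure.dirac a) := fun a =>
    (integrable_dirac (by simp)).smul_measure (measure_ne_top D _)
  have hint : ∫ x, x ∂D = D.real {c} * c := by
    conv_lhs => rw [e]
    rw [integral_add_measure (hi _) (hi _), integral_smul_measure,
      integral_smul_measure, integral_dirac, integral_dirac]
    simp [measureReal_def]
  have hsum : D {0} + D {c} = 1 := by
    have := measure_univ (μ := D)
    rw [e] at this
    simpa using this
  have hsumr : D.real {0} + D.real {c} = 1 := by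
    rw [measureReal_def, measureReal_def, ← ENNReal.toReal_add (measure_ne_top D _)
      (measure_ne_top D _), hsum, ENNReal.toReal_one]
  refine ⟨?_, ?_, ?_⟩
  · rw [twoPointLaw, hint, mul_div_assoc, div_self hc.ne', mul_one,
      show 1 - D.real {c} = D.real {0} by linarith, measureReal_def, measureReal_def,
      ENNReal.ofReal_toReal (measure_ne_top D _), ENNReal.ofReal_toReal (measure_ne_top D _)]
    exact e
  · rw [hint]; positivity
  · rw [hint]
    have : D.real {c} ≤ 1 := measureReal_le_one
    nlinarith

/-- The common mass stays in place and only `|m - m'| / c` travels the distance `c`. -/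
theorem otCost_twoPointLaw_le {c m m' : ℝ} (hc : 0 < c) (h0 : 0 ≤ m) (hm : m ≤ c)
    (h0' : 0 ≤ m') (hm' : m' ≤ c) :
    otCost (twoPointLaw c m) (twoPointLaw c m') ≤ ENNReal.ofReal (c * |m - m'|) := by
  have := isProbabilityMeasure_twoPointLaw hc h0 hm
  set p := m / c with hp
  set p' := m' / c with hp'
  have hp0 : 0 ≤ p := by positivity
  have hp0' : 0 ≤ p' := by positivity
  have hp1 : p ≤ 1 := (div_le_one hc).2 hm
  have hp1' : p' ≤ 1 := (div_le_one hc).2 hm'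
  -- `ENNReal.ofReal` truncates at `0`, so at most one of the last two terms survives and both
  -- orders of `p`, `p'` are covered.
  set Γ : Measure (ℝ × ℝ) := ENNReal.ofReal (1 - max p p') • Measure.dirac (0, 0)
    + ENNReal.ofReal (min p p') • Measure.dirac (c, c)
    + ENNReal.ofReal (p - p') • Measure.dirac (c, 0)
    + ENNReal.ofReal (p' - p) • Measure.dirac (0, c) with hΓ
  have hfst : Γ.map Prod.fst = twoPointLaw c m := by
    simp only [hΓ, Measure.map_add _ _ measurable_fst, Measure.map_smul,
      Measure.map_dirac' measurable_fst, twoPointLaw, ← hp]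
    rw [show ENNReal.ofReal (1 - p) = ENNReal.ofReal (1 - max p p') + ENNReal.ofReal (p' - p) by
      rcases le_total p p' with h | h
      · rw [← ENNReal.ofReal_add (by simp [hp1, hp1']) (by linarith), max_eq_right h]; ring_nf
      · rw [ENNReal.ofReal_of_nonpos (by linarith : p' - p ≤ 0), max_eq_left h, add_zero],
      show ENNReal.ofReal p = ENNReal.ofReal (min p p') + ENNReal.ofReal (p - p') by
      rcases le_total p p' with h | h
      · rw [ENNReal.ofReal_of_nonpos (by linarith : p - p' ≤ 0), min_eq_left h, add_zero]
      · rw [← ENNReal.ofReal_add (by simp [hp0, hp0']) (by linarith), min_eq_right h]; ring_nf]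
    rw [add_smul, add_smul]
    abel
  have hsnd : Γ.map Prod.snd = twoPointLaw c m' := by
    simp only [hΓ, Measure.map_add _ _ measurable_snd, Measure.map_smul,
      Measure.map_dirac' measurable_snd, twoPointLaw, ← hp']
    rw [show ENNReal.ofReal (1 - p') = ENNReal.ofReal (1 - max p p') + ENNReal.ofReal (p - p') by
      rcases le_total p p' with h | h
      · rw [ENNReal.ofReal_of_nonpos (by linarith : p - p' ≤ 0), max_eq_right h, add_zero]
      · rw [← ENNReal.ofReal_add (by simp [hp1, hp1']) (by linarith), max_eq_left h]; ring_nf,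
      show ENNReal.ofReal p' = ENNReal.ofReal (min p p') + ENNReal.ofReal (p' - p) by
      rcases le_total p p' with h | h
      · rw [← ENNReal.ofReal_add (by simp [hp0, hp0']) (by linarith), min_eq_left h]; ring_nf
      · rw [ENNReal.ofReal_of_nonpos (by linarith : p' - p ≤ 0), min_eq_right h, add_zero]]
    rw [add_smul, add_smul]
    abel
  have hprob : IsProbabilityMeasure Γ := by
    constructor
    rw [← Set.preimage_univ (f := (Prod.fst : ℝ × ℝ → ℝ)),
      ← Measure.map_apply measurable_fst MeasurableSet.univ, hfst, measure_univ]
  refine (iInf₂_le Γ ⟨hprob, hfst, hsnd⟩).trans ?_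
  rw [show c * |m - m'| = |p - p'| * c ^ 2 by
    rw [hp, hp', ← sub_div, abs_div, abs_of_pos hc]; field_simp]
  simp only [hΓ, lintegral_add_measure, lintegral_smul_measure, lintegral_dirac]
  simp only [sub_self, abs_zero, sub_zero, zero_sub, abs_neg, sq_abs, smul_eq_mul]
  rw [← ENNReal.ofReal_mul' (sq_nonneg c), ← ENNReal.ofReal_mul' (sq_nonneg c)]
  rcases le_total p p' with h | h
  · rw [ENNReal.ofReal_of_nonpos (p := (p - p') * c ^ 2)
      (mul_nonpos_of_nonpos_of_nonneg (by linarith) (sq_nonneg c)), abs_of_nonpos (by linarith)]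
    simp
  · rw [ENNReal.ofReal_of_nonpos (p := (p' - p) * c ^ 2)
      (mul_nonpos_of_nonpos_of_nonneg (by linarith) (sq_nonneg c)), abs_of_nonneg (by linarith)]
    simp

/-! ### Concentration of empirical averages. -/

/-- Chebyshev's inequality for empirical averages. -/
theorem measure_pi_le_abs_average_sub_le {D : Measure ℝ} [IsProbabilityMeasure D] {f : ℝ → ℝ}
    (hf : MemLp f 2 D) {N : ℕ} (hN : 0 < N) {t : ℝ} (ht : 0 < t) :
    Measure.pi (fun _ : Fin N => D) {v | t ≤ |1 / (N : ℝ) * ∑ i, f (v i) - ∫ x, f x ∂D|} ≤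
      ENNReal.ofReal (variance f D / (N * t ^ 2)) := by
  have hN' : (0 : ℝ) < N := by exact_mod_cast hN
  have hi : ∀ i : Fin N, MemLp (fun v : Fin N → ℝ => f (v i)) 2 (Measure.pi fun _ => D) :=
    fun i => hf.comp_measurePreserving (measurePreserving_eval (fun _ : Fin N => D) i)
  have hS : MemLp (∑ i, fun v : Fin N → ℝ => f (v i)) 2 (Measure.pi fun _ => D) :=
    memLp_finsetSum' _ fun i _ => hi i
  have hE : ∫ v, (∑ i, fun v : Fin N → ℝ => f (v i)) v ∂(Measure.pi fun _ => D)
      = N * ∫ x, f x ∂D := by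
    simp only [Finset.sum_apply]
    rw [integral_finsetSum _ fun i _ => (hi i).integrable (by norm_num)]
    simp [integral_comp_eval (μ := fun _ : Fin N => D) hf.aestronglyMeasurable]
  have h := meas_ge_le_variance_div_sq hS (mul_pos hN' ht)
  rw [variance_sum_pi (X := fun _ => f) fun _ => hf, hE] at h
  convert! h using 2
  · ext v
    rw [Set.mem_ofPred_eq, Set.mem_ofPred_eq, Finset.sum_apply,
      show ∑ i, f (v i) - N * ∫ x, f x ∂D
        = N * (1 / (N : ℝ) * ∑ i, f (v i) - ∫ x, f x ∂D) by field_simp,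
      abs_mul, abs_of_pos hN', mul_le_mul_iff_right₀ hN']
  · simp
    field_simp

/-- Hoeffding's inequality for the sample mean of a law on `[0, c]`. -/
theorem measure_pi_le_abs_sampleMean_sub_le {D : Measure ℝ} [IsProbabilityMeasure D] {c : ℝ}
    (hc : 0 < c) (hD : ∀ᵐ x ∂D, x ∈ Set.Icc 0 c) {N : ℕ} (hN : 0 < N) {t : ℝ} (ht : 0 ≤ t) :
    (Measure.pi fun _ : Fin N => D).real {v | t ≤ |sampleMean v - ∫ x, x ∂D|} ≤
      2 * Real.exp (-(2 * N * t ^ 2 / c ^ 2)) := by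
  have hN' : (0 : ℝ) < N := by exact_mod_cast hN
  set P := Measure.pi fun _ : Fin N => D with hP
  have hae : ∀ i : Fin N, ∀ᵐ v ∂P, v i ∈ Set.Icc 0 c := fun i =>
    (Measure.quasiMeasurePreserving_eval (fun _ : Fin N => D) i).ae hD
  have hmean : ∀ i : Fin N, ∫ v : Fin N → ℝ, v i ∂P = ∫ x, x ∂D := fun i =>
    integral_comp_eval (μ := fun _ : Fin N => D) (f := fun x : ℝ => x) aestronglyMeasurable_id
  have hsub : ∀ i : Fin N, HasSubgaussianMGF (fun v : Fin N → ℝ => v i - ∫ x, x ∂D)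
      ((‖c - 0‖₊ / 2) ^ 2) P := fun i => by
    have := hasSubgaussianMGF_of_mem_Icc (measurable_pi_apply i).aemeasurable (hae i)
    rwa [hmean i] at this
  have hind : iIndepFun (fun (i : Fin N) (v : Fin N → ℝ) => v i - ∫ x, x ∂D) P :=
    iIndepFun_pi (X := fun _ x => x - ∫ x, x ∂D) fun _ => by fun_prop
  have hind' : iIndepFun (fun (i : Fin N) (v : Fin N → ℝ) => -(v i - ∫ x, x ∂D)) P :=
    iIndepFun_pi (X := fun _ x => -(x - ∫ x, x ∂D)) fun _ => by fun_prop
  have hNt : 0 ≤ N * t := by positivity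
  have h1 := HasSubgaussianMGF.measure_sum_ge_le_of_iIndepFun hind
    (s := Finset.univ) (fun i _ => hsub i) hNt
  have h2 := HasSubgaussianMGF.measure_sum_ge_le_of_iIndepFun hind'
    (s := Finset.univ) (fun i _ => (hsub i).neg) hNt
  have hexp : -(N * t) ^ 2 / (2 * ((∑ _i : Fin N, (‖c - 0‖₊ / 2) ^ 2 : ℝ≥0) : ℝ))
      = -(2 * N * t ^ 2 / c ^ 2) := by
    simp [abs_of_pos hc]
    field_simp
  rw [hexp] at h1 h2
  have hs : ∀ v : Fin N → ℝ, ∑ i, (v i - ∫ x, x ∂D) = N * (sampleMean v - ∫ x, x ∂D) := by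
    intro v
    rw [sampleMean, Finset.sum_sub_distrib, Finset.sum_const, Finset.card_univ, Fintype.card_fin,
      nsmul_eq_mul]
    field_simp
  rw [two_mul]
  refine (measureReal_mono ?_).trans ((measureReal_union_le _ _).trans (add_le_add h1 h2))
  intro v hv
  simp only [Set.mem_union, Set.mem_ofPred_eq, Finset.sum_neg_distrib, hs] at hv ⊢
  rw [← mul_neg, mul_le_mul_iff_right₀ hN', mul_le_mul_iff_right₀ hN']
  exact le_abs.1 hv

/-- Subadditivity replaces complementation, so the event `t` need not be shown measurable. -/
theorem ofReal_one_sub_le_measure_of_compl_le {Ω : Type*} [MeasurableSpace Ω] {P : Measure Ω}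
    [IsProbabilityMeasure P] {s t : Set Ω} {η : ℝ} (hη : 0 ≤ η)
    (hs : P s ≤ ENNReal.ofReal η) (hst : ∀ᵐ ω ∂P, ω ∉ s → ω ∈ t) :
    ENNReal.ofReal (1 - η) ≤ P t := by
  have h : (1 : ℝ≥0∞) ≤ P s + P t := by
    rw [← measure_univ (μ := P)]
    refine (measure_mono_ae ?_).trans (measure_union_le s t)
    filter_upwards [hst] with ω h _
    by_cases hω : ω ∈ s
    · exact Or.inl hω
    · exact Or.inr (h hω)
  rw [ENNReal.ofReal_sub 1 hη, ENNReal.ofReal_one, tsub_le_iff_right, add_comm]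
  exact h.trans (by gcongr)

/-! ### The dichotomy and the estimate in each case. -/

/-- A law on `ℝ₊` either charges at most one point besides `0`, or is not concentrated on a single
point within some half-line `[ε, ∞)` with `ε > 0`. -/
theorem exists_ae_eq_zero_or_eq {D : Measure ℝ} (hD : D ∈ demandDistributions)
    (h : ∀ ε > 0, ∃ c, ∀ᵐ x ∂D, ε ≤ x → x = c) : ∃ c, ∀ᵐ x ∂D, x = 0 ∨ x = c := by
  obtain ⟨-, hD0⟩ := hD
  have hnn : ∀ᵐ x ∂D, 0 ≤ x := by
    filter_upwards [measure_eq_zero_iff_ae_notMem.1 hD0] with x hx using not_lt.1 hx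
  choose! c hc using h
  have hpos : ∀ x : ℝ, 0 < x → ∃ n : ℕ, 1 / ((n : ℝ) + 1) < x := fun x hx =>
    exists_nat_one_div_lt hx
  by_cases hz : ∀ n : ℕ, ∀ᵐ x ∂D, x < 1 / ((n : ℝ) + 1)
  · refine ⟨0, ?_⟩
    filter_upwards [hnn, ae_all_iff.2 hz] with x hx hxn
    left
    by_contra hne
    obtain ⟨n, hn⟩ := hpos x (lt_of_le_of_ne hx (Ne.symm hne))
    exact absurd (hxn n) hn.le.not_gt
  · obtain ⟨n₀, hn₀⟩ := not_forall.1 hz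
    have hfr : ∃ᵐ x ∂D, 1 / ((n₀ : ℝ) + 1) ≤ x := by
      simpa only [Filter.Frequently, not_le] using hn₀
    set ε₀ := 1 / ((n₀ : ℝ) + 1) with hε₀
    have hε₀0 : 0 < ε₀ := by positivity
    -- Since `[ε₀, ∞)` has positive mass, a point of it is seen by both half-lines and forces the
    -- same atom.
    have heq : ∀ ε, 0 < ε → ε ≤ ε₀ → c ε = c ε₀ := fun ε h0 hle => by
      obtain ⟨x, hx, h1, h2⟩ := (hfr.and_eventually ((hc ε h0).and (hc ε₀ hε₀0))).exists
      rw [← h1 (hle.trans hx), ← h2 hx]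
    refine ⟨c ε₀, ?_⟩
    have hall : ∀ n : ℕ, ∀ᵐ x ∂D, min ε₀ (1 / ((n : ℝ) + 1)) ≤ x → x = c ε₀ := fun n => by
      have h0 : 0 < min ε₀ (1 / ((n : ℝ) + 1)) := lt_min hε₀0 (by positivity)
      rw [← heq _ h0 (min_le_left _ _)]
      exact hc _ h0
    filter_upwards [hnn, ae_all_iff.2 hall] with x hx hxn
    by_cases hx0 : x = 0
    · exact Or.inl hx0
    · obtain ⟨n, hn⟩ := hpos x (lt_of_le_of_ne hx (Ne.symm hx0))
      exact Or.inr (hxn n ((min_le_right _ _).trans hn.le))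

/-- The estimate for a law that is not concentrated on a single point within `[ε, ∞)`. -/
theorem eventually_le_measure_otCostToSet_of_not_ae_eq {D : Measure ℝ}
    (hD : D ∈ demandDistributions) (h4 : MemLp id 4 D) {ε : ℝ} (hε : 0 < ε)
    (hne : ¬ ∃ c, ∀ᵐ x ∂D, ε ≤ x → x = c) {κ η : ℝ} (hκ : 0 < κ) (hη : 0 < η) :
    ∀ᶠ N : ℕ in atTop, ENNReal.ofReal (1 - η) ≤ Measure.pi (fun _ : Fin N => D)
      {v | otCostToSet D (estimatedSet v) ≤ ENNReal.ofReal (κ / Real.sqrt N)} := by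
  have := hD.1
  have h2 : MemLp id 2 D := h4.mono_exponent (by norm_num)
  have h22 : MemLp (fun x : ℝ => x ^ 2) 2 D := by
    rw [memLp_two_iff_integrable_sq (by fun_prop)]
    have := h4.integrable_norm_pow (p := 4) (by norm_num)
    refine this.congr (ae_of_all _ fun x => ?_)
    simp only [id, Real.norm_eq_abs]
    rw [← pow_mul]
    exact (Even.pow_abs (by decide) x)
  obtain ⟨C, r, hC, hr, hCr⟩ := exists_otCostToSet_le_sq hD h2 hε hne
  set W := variance id D + variance (fun x : ℝ => x ^ 2) D with hW
  have hsqrt : Tendsto (fun N : ℕ => Real.sqrt N) atTop atTop :=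
    Real.tendsto_sqrt_atTop.comp tendsto_natCast_atTop_atTop
  filter_upwards [eventually_gt_atTop 0, hsqrt.eventually_ge_atTop (κ / C / r ^ 2),
    hsqrt.eventually_ge_atTop (W * C / κ / η)] with N hN hNr hNW
  have hN' : (0 : ℝ) < N := by exact_mod_cast hN
  have hs : 0 < Real.sqrt N := Real.sqrt_pos.2 hN'
  have hss : Real.sqrt N * Real.sqrt N = N := Real.mul_self_sqrt hN'.le
  -- Chosen so that `C * t ^ 2 = κ / √N`; the Chebyshev bound is then `W * C / (κ * √N)`, at most
  -- `η` by `hNW`.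
  set t := Real.sqrt (κ / C / Real.sqrt N) with ht
  have ht0 : 0 < t := Real.sqrt_pos.2 (by positivity)
  have htsq : t ^ 2 = κ / C / Real.sqrt N := Real.sq_sqrt (by positivity)
  have htr : t ≤ r := by
    refine abs_le_of_sq_le_sq' ?_ hr.le |>.2
    rw [htsq, div_le_iff₀ hs]
    rwa [div_le_iff₀ (by positivity), mul_comm] at hNr
  have hb1 := measure_pi_le_abs_average_sub_le h2 hN ht0
  have hb2 := measure_pi_le_abs_average_sub_le h22 hN ht0
  refine ofReal_one_sub_le_measure_of_compl_le hη.le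
    ((measure_union_le _ _).trans ((add_le_add hb1 hb2).trans ?_)) (ae_of_all _ fun v hv => ?_)
  · have hvar := variance_nonneg (μ := D)
    rw [← ENNReal.ofReal_add (div_nonneg (hvar _) (by positivity))
      (div_nonneg (hvar _) (by positivity)), ← add_div, ← hW]
    refine ENNReal.ofReal_le_ofReal ?_
    rw [div_le_iff₀ hη, div_le_iff₀ hκ] at hNW
    rw [htsq, ← hss, div_le_iff₀ (by positivity)]
    calc W = W * C / C := by field_simp
      _ ≤ Real.sqrt N * η * κ / C := by gcongr
      _ = _ := by field_simp; rw [Real.sqrt_sq hs.le]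
  · simp only [Set.mem_union, Set.mem_ofPred_eq, not_or, not_le] at hv
    have := hCr t (sampleMean v) (1 / (N : ℝ) * ∑ i, v i ^ 2) htr hv.1.le hv.2.le
    rw [htsq] at this
    refine this.trans (ENNReal.ofReal_le_ofReal (le_of_eq ?_))
    field_simp

/-- The estimate for a law on `{0, c}`. -/
theorem le_measure_otCostToSet_of_ae_eq {D : Measure ℝ} [IsProbabilityMeasure D] {c : ℝ}
    (hc : 0 < c) (hD : ∀ᵐ x ∂D, x = 0 ∨ x = c) {η : ℝ} (hη : 0 < η) (hη1 : η ≤ 1) {N : ℕ}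
    (hN : 0 < N) :
    ENNReal.ofReal (1 - η) ≤ Measure.pi (fun _ : Fin N => D)
      {v | otCostToSet D (estimatedSet v) ≤
        ENNReal.ofReal (((1 + c) + (1 + c) * Real.log (1 / η)) ^ 2 / Real.sqrt N)} := by
  have hN' : (0 : ℝ) < N := by exact_mod_cast hN
  have hs : 0 < Real.sqrt N := Real.sqrt_pos.2 hN'
  have hss : Real.sqrt N ^ 2 = N := Real.sq_sqrt hN'.le
  set L := Real.log (1 / η) with hL
  have hL0 : 0 ≤ L := Real.log_nonneg ((one_le_div hη).2 hη1)
  set y := Real.log (2 / η) with hy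
  have hyL : y = Real.log 2 + L := by
    rw [hy, hL, ← Real.log_mul (by norm_num) (by positivity)]; congr 1; ring
  have hy0 : 0 ≤ y := by rw [hyL]; have := Real.log_nonneg one_le_two; linarith
  have hy1 : y ≤ 1 + L := by
    rw [hyL]; have := Real.log_le_sub_one_of_pos (zero_lt_two (α := ℝ)); linarith
  -- The deviation at which Hoeffding's bound equals `η`.
  set t := c * Real.sqrt (y / 2) / Real.sqrt N with ht
  have ht0 : 0 ≤ t := by positivity
  have hIcc : ∀ᵐ x ∂D, x ∈ Set.Icc 0 c := by
    filter_upwards [hD] with x hx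
    rcases hx with rfl | rfl
    · exact ⟨le_rfl, hc.le⟩
    · exact ⟨hc.le, le_rfl⟩
  have hH := measure_pi_le_abs_sampleMean_sub_le hc hIcc hN ht0
  have hexp : 2 * Real.exp (-(2 * N * t ^ 2 / c ^ 2)) = η := by
    have : 2 * N * t ^ 2 / c ^ 2 = y := by
      rw [ht, div_pow, mul_pow, Real.sq_sqrt (by positivity), hss]
      field_simp
    rw [this, hy, Real.exp_neg, Real.exp_log (by positivity)]
    field_simp
  rw [hexp] at hH
  obtain ⟨hDe, hm0, hmc⟩ := eq_twoPointLaw hc hD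
  have hall : ∀ᵐ v ∂(Measure.pi fun _ : Fin N => D), ∀ i, v i = 0 ∨ v i = c :=
    ae_all_iff.2 fun i => (Measure.quasiMeasurePreserving_eval (fun _ : Fin N => D) i).ae hD
  refine ofReal_one_sub_le_measure_of_compl_le hη.le
    (s := {v | t ≤ |sampleMean v - ∫ x, x ∂D|}) ?_ ?_
  · rw [← ofReal_measureReal]
    exact ENNReal.ofReal_le_ofReal hH
  filter_upwards [hall] with v hv hvt
  replace hvt := not_le.1 hvt
  have hS0 : 0 ≤ sampleMean v := mul_nonneg (by positivity) <| Finset.sum_nonneg fun i _ => by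
    rcases hv i with h | h <;> rw [h]
    exact hc.le
  have hSc : sampleMean v ≤ c := by
    have : ∑ i, v i ≤ ∑ _i : Fin N, c := Finset.sum_le_sum fun i _ => by
      rcases hv i with h | h <;> rw [h]
      exact hc.le
    rw [Finset.sum_const, Finset.card_univ, Fintype.card_fin, nsmul_eq_mul] at this
    rw [sampleMean, div_mul_eq_mul_div, one_mul, div_le_iff₀ hN']
    linarith
  -- On `{0, c}` squaring is multiplication by `c`, so the sample mean determines the sample
  -- variance.
  have hV : sampleVariance v = c * sampleMean v - sampleMean v ^ 2 := by
    have : ∀ i, v i ^ 2 = c * v i := fun i => by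
      rcases hv i with h | h <;> rw [h] <;> ring
    simp only [sampleVariance, sampleMean, this, ← Finset.mul_sum]
    ring
  have hmem : twoPointLaw c (sampleMean v) ∈ estimatedSet v := by
    rw [estimatedSet, hV]
    exact twoPointLaw_mem_meanVarianceSet hc hS0 hSc
  refine (otCostToSet_le_of_mem hmem).trans ?_
  have hcost := otCost_twoPointLaw_le hc hm0 hmc hS0 hSc
  rw [← hDe] at hcost
  refine hcost.trans (ENNReal.ofReal_le_ofReal ?_)
  rw [abs_sub_comm]
  have hsq : Real.sqrt (y / 2) ≤ 1 + L := by
    rw [Real.sqrt_le_left (by positivity)]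
    nlinarith
  calc c * |sampleMean v - ∫ x, x ∂D| ≤ c * t := by gcongr
    _ = c ^ 2 * Real.sqrt (y / 2) / Real.sqrt N := by rw [ht]; ring
    _ ≤ ((1 + c) + (1 + c) * L) ^ 2 / Real.sqrt N := by
      gcongr
      calc c ^ 2 * Real.sqrt (y / 2) ≤ (1 + c) ^ 2 * (1 + L) := by gcongr; linarith
        _ ≤ (1 + c) ^ 2 * (1 + L) ^ 2 := by gcongr; nlinarith
        _ = _ := by ring

/-! ### The constants and the conclusion. -/

/-- The positive atom of a law on `{0, c}` with mean `μ` and variance `σ²`, normalised to `1` when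
the law is the point mass at `0`. -/
noncomputable def positiveAtom (μ σ : ℝ) : ℝ :=
  if 0 < μ then (μ ^ 2 + σ ^ 2) / μ else 1

theorem positiveAtom_pos (μ σ : ℝ) : 0 < positiveAtom μ σ := by
  unfold positiveAtom
  split_ifs <;> positivity

/-- On `{0, c}` the second moment is `c` times the mean, which determines `c` unless the mean is
`0`; then `D` is the point mass at `0` and any atom serves. This lets the constants be fixed before
`D`. -/
theorem ae_eq_zero_or_eq_positiveAtom {D : Measure ℝ} (hD : D ∈ demandDistributions)
    (h2 : MemLp id 2 D) {σ c : ℝ} (hσ : variance id D = σ ^ 2) (hc : ∀ᵐ x ∂D, x = 0 ∨ x = c) :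
    ∀ᵐ x ∂D, x = 0 ∨ x = positiveAtom (∫ x, x ∂D) σ := by
  obtain ⟨_, hD0⟩ := hD
  have hnn : ∀ᵐ x ∂D, 0 ≤ x := by
    filter_upwards [measure_eq_zero_iff_ae_notMem.1 hD0] with x hx using not_lt.1 hx
  by_cases hμ : 0 < ∫ x, x ∂D
  · have hv := variance_eq_sub h2
    have hsq : ∫ x, (id ^ 2 : ℝ → ℝ) x ∂D = c * ∫ x, x ∂D := by
      rw [← integral_const_mul]
      refine integral_congr_ae ?_
      filter_upwards [hc] with x hx
      rcases hx with rfl | rfl <;> simp [sq]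
    have he : c = positiveAtom (∫ x, x ∂D) σ := by
      rw [positiveAtom, if_pos hμ, eq_div_iff hμ.ne']
      rw [hσ, hsq] at hv
      simp only [id] at hv
      linarith
    rwa [← he]
  · have h0 : ∫ x, x ∂D = 0 := le_antisymm (not_lt.1 hμ) (integral_nonneg_of_ae hnn)
    have := (integral_eq_zero_iff_of_nonneg_ae hnn (h2.integrable (by norm_num))).1 h0
    filter_upwards [this] with x hx using Or.inl hx

theorem proposition4 (μ σ : ℝ) (ν : ℝ≥0) (hσ : 0 ≤ σ) :
    ∃ c₁ c₂ : ℝ, 0 < c₁ ∧ 0 < c₂ ∧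
      ∀ D : Measure ℝ, D ∈ demandDistributions →
        ∫ x, x ∂D = μ →
        variance id D = σ ^ 2 →
        HasSubgaussianMGF (fun x : ℝ => x - μ) (ν ^ 2) D →
        ∀ η : ℝ, 0 < η → η ≤ 1 →
          ∀ᶠ N : ℕ in atTop,
            ENNReal.ofReal (1 - η) ≤
              Measure.pi (fun _ : Fin N => D)
                {v : Fin N → ℝ | otCostToSet D (estimatedSet v) ≤
                  ENNReal.ofReal ((c₁ + c₂ * Real.log (1 / η)) ^ 2 / Real.sqrt (N : ℝ))} := by
  have hc := positiveAtom_pos μ σ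
  refine ⟨1 + positiveAtom μ σ, 1 + positiveAtom μ σ, by positivity, by positivity,
    fun D hD hμ hvar hsub η hη hη1 => ?_⟩
  have := hD.1
  have h4 : MemLp id 4 D := by
    have h := (hsub.memLp 4).add (memLp_const μ)
    refine MemLp.congr_norm h aestronglyMeasurable_id (ae_of_all _ fun x => ?_)
    simp
  by_cases hne : ∀ ε > 0, ∃ c, ∀ᵐ x ∂D, ε ≤ x → x = c
  · obtain ⟨c, hc'⟩ := exists_ae_eq_zero_or_eq hD hne
    have hD' := ae_eq_zero_or_eq_positiveAtom hD (h4.mono_exponent (by norm_num)) hvar hc'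
    rw [hμ] at hD'
    filter_upwards [eventually_gt_atTop 0] with N hN
    exact le_measure_otCostToSet_of_ae_eq hc hD' hη hη1 hN
  · simp only [not_forall] at hne
    obtain ⟨ε, hε, hne⟩ := hne
    have hL : 0 ≤ Real.log (1 / η) := Real.log_nonneg ((one_le_div hη).2 hη1)
    -- Here `κ` is the squared numerator; only its positivity matters.
    exact eventually_le_measure_otCostToSet_of_not_ae_eq hD h4 hε hne (by positivity) hη
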